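/- A \emph{hypergraph} $\mathcal{C}$ on a finite vertex set $V$ is a family of pairwise incomparable subsets of $V$ (its edges), each of cardinality at least $2$. Its \emph{independence complex} $\operatorname{Ind}(\mathcal{C})$ is the simplicial complex whose faces are the subsets of $V$ that contain no edge of $\mathcal{C}$. For an edge $F$ of $\mathcal{C}$, let $\mathcal{C}-F$ be the hypergraph on $V$ obtained by removing the edge $F$; let $N_{\mathcal{C}}(F)$ be the union of the sets $E\setminus F$ over all $E\in\mathcal{C}$ with $|E\setminus F|=1$; and let $\mathcal{C}:F$ be the hypergraph on $V\setminus(F\cup N_{\mathcal{C}}(F))$ whose edges are those inclusion-minimal members of $\{E\setminus F : E\in\mathcal{C}-F\}$ that have cardinality at least $2$. Define $\psi(\mathcal{C})\in\mathbb{Z}_{\ge 0}\cup\{\infty\}$ recursively by $$\psi(\mathcal{C})=\begin{cases}0, & \text{if } V=\emptyset,\\ \infty, & \text{if } V\neq\emptyset \text{ and } \mathcal{C}=\emptyset,\\ \max_{F\in\mathcal{C}}\min\{\psi(\mathcal{C}-F),\ \psi(\mathcal{C}:F)+|F|-1\}, & \text{otherwise.}\end{cases}$$ For a simplicial complex $\Delta$,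 let the \emph{homological connectivity} $\operatorname{conn_h}(\Delta)$ be the greatest integer $k$ such that the reduced simplicial homology group $\tilde H_i(\Delta;\mathbb{Z})$ vanishes for every $-1\le i\le k$, and let $\operatorname{conn_h}(\Delta)=\infty$ if all these groups vanish; in particular $\operatorname{conn_h}(\{\emptyset\})=-2$. Then for every hypergraph $\mathcal{C}$, $$\operatorname{conn_h}(\operatorname{Ind}(\mathcal{C}))\ \ge\ \psi(\mathcal{C})-2 .$$ -/

import Mathlib

open Finset

/-! ### Hypergraphs -/

/-- A hypergraph on a finite vertex set `verts`: a family of pairwise incomparable subsets of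
`verts` (the edges), each of cardinality at least `2`. -/
@[ext]
structure FinHypergraph (α : Type*) where
  verts : Finset α
  edges : Finset (Finset α)
  subset_verts : ∀ E ∈ edges, E ⊆ verts
  two_le_card : ∀ E ∈ edges, 2 ≤ E.card
  incomparable : ∀ E ∈ edges, ∀ G ∈ edges, E ⊆ G → E = G

namespace FinHypergraph

variable {α : Type*}

/-- The independence complex `Ind(C)`: its faces are the sets of vertices containing no edge.
Mathlib's simplicial complexes record only the nonempty faces; the empty face is always understood
to be there, see `augFaces`. -/
def indepComplex (C : FinHypergraph α) : PreAbstractSimplicialComplex α where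
  faces := {s | s.Nonempty ∧ s ⊆ C.verts ∧ ∀ E ∈ C.edges, ¬ E ⊆ s}
  isRelLowerSet_faces := by
    rintro s ⟨hs, hsV, hsE⟩
    exact ⟨hs, fun t hts ht => ⟨ht, hts.trans hsV, fun E hE hEt => hsE E hE (hEt.trans hts)⟩⟩

variable [DecidableEq α]

/-- `C - F`: remove the edge `F`, keep all vertices. -/
def deleteEdge (C : FinHypergraph α) (F : Finset α) : FinHypergraph α where
  verts := C.verts
  edges := C.edges.erase F
  subset_verts E hE := C.subset_verts E (mem_of_mem_erase hE)
  two_le_card E hE := C.two_le_card E (mem_of_mem_erase hE)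
  incomparable E hE G hG := C.incomparable E (mem_of_mem_erase hE) G (mem_of_mem_erase hG)

/-- The vertex neighbour set `N_C(F)`: the union of the sets `E \ F` over the edges `E` with
`|E \ F| = 1`. -/
def nbr (C : FinHypergraph α) (F : Finset α) : Finset α :=
  (C.edges.filter fun E => (E \ F).card = 1).biUnion fun E => E \ F

/-- The family `{E \ F : E an edge of C - F}`. -/
def traces (C : FinHypergraph α) (F : Finset α) : Finset (Finset α) :=
  (C.edges.erase F).image fun E => E \ F

/-- `C : F`: the hypergraph on `V \ (F ∪ N_C(F))` whose edges are the inclusion-minimal members of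
`{E \ F : E an edge of C - F}` that have cardinality at least `2`. -/
def contract (C : FinHypergraph α) (F : Finset α) : FinHypergraph α where
  verts := C.verts \ (F ∪ C.nbr F)
  edges := (C.traces F).filter fun S => (∀ T ∈ C.traces F, T ⊆ S → T = S) ∧ 2 ≤ S.card
  subset_verts := by
    intro S hS
    simp only [mem_filter] at hS
    obtain ⟨hST, hmin, hcard⟩ := hS
    obtain ⟨E, hE, rfl⟩ := mem_image.1 hST
    intro v hv
    have hvE := mem_sdiff.1 hv
    refine mem_sdiff.2 ⟨C.subset_verts E (mem_of_mem_erase hE) hvE.1, fun hvF => ?_⟩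
    rcases mem_union.1 hvF with h | h
    · exact hvE.2 h
    · simp only [nbr, mem_biUnion, mem_filter] at h
      obtain ⟨G, ⟨hG, hG1⟩, hvG⟩ := h
      have hGF : G ≠ F := by
        rintro rfl
        simp at hG1
      have hsub : G \ F ⊆ E \ F := by
        obtain ⟨w, hw⟩ := card_eq_one.1 hG1
        rw [hw, mem_singleton] at hvG
        rw [hw, ← hvG]
        exact singleton_subset_iff.2 hv
      have := hmin _ (mem_image.2 ⟨G, mem_erase.2 ⟨hGF, hG⟩, rfl⟩) hsub
      rw [← this, hG1] at hcard
      omega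
  two_le_card S hS := (mem_filter.1 hS).2.2
  incomparable S hS T hT h := (mem_filter.1 hT).2.1 S (mem_filter.1 hS).1 h

theorem card_edges_deleteEdge_lt (C : FinHypergraph α) {F : Finset α} (hF : F ∈ C.edges) :
    (C.deleteEdge F).edges.card < C.edges.card :=
  card_erase_lt_of_mem hF

theorem card_edges_contract_lt (C : FinHypergraph α) {F : Finset α} (hF : F ∈ C.edges) :
    (C.contract F).edges.card < C.edges.card :=
  ((card_filter_le _ _).trans card_image_le).trans_lt (card_erase_lt_of_mem hF)

/-- The recursively defined number `ψ(C)`, a natural number or `∞`. In the last case the supremum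
is over a nonempty finite family, so it is a maximum. -/
noncomputable def psi (C : FinHypergraph α) : ℕ∞ :=
  if C.verts = ∅ then 0
  else if C.edges = ∅ then ⊤
  else C.edges.attach.sup fun F =>
    min (psi (C.deleteEdge F.1)) (psi (C.contract F.1) + ((F.1.card - 1 : ℕ) : ℕ∞))
termination_by C.edges.card
decreasing_by
  · exact C.card_edges_deleteEdge_lt F.2
  · exact C.card_edges_contract_lt F.2

end FinHypergraph

/-! ### Reduced simplicial homology with integer coefficients -/

namespace PreAbstractSimplicialComplex

variable {α : Type*}

/-- The faces of `K` together with the empty face, which has dimension `-1`. -/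
def augFaces (K : PreAbstractSimplicialComplex α) : Set (Finset α) := insert ∅ K.faces

/-- The augmented chain group in degree `i`: the free abelian group on the faces of dimension `i`,
that is, on the faces with `i + 1` vertices. -/
noncomputable def chains (K : PreAbstractSimplicialComplex α) (i : ℤ) :
    Submodule ℤ (Finset α →₀ ℤ) :=
  Finsupp.supported ℤ ℤ {s | s ∈ K.augFaces ∧ (s.card : ℤ) = i + 1}

variable [LinearOrder α]

/-- The boundary of the simplex with vertices `v₀ < ⋯ < vₙ`, namely
`∑ j, (-1)^j [v₀, …, v_{j-1}, v_{j+1}, …, vₙ]`; the position `j` of a vertex `v` is the number of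
vertices before `v`. The boundary of a point is the empty simplex (the augmentation). -/
noncomputable def simplexBoundary (s : Finset α) : Finset α →₀ ℤ :=
  ∑ v ∈ s, Finsupp.single (s.erase v) ((-1 : ℤ) ^ (s.filter (· < v)).card)

/-- The boundary operator, the linear extension of `simplexBoundary`. -/
noncomputable def boundary : (Finset α →₀ ℤ) →ₗ[ℤ] (Finset α →₀ ℤ) :=
  Finsupp.linearCombination ℤ simplexBoundary

theorem boundary_single (s : Finset α) (a : ℤ) :
    boundary (Finsupp.single s a) = a • simplexBoundary s := by
  simp [boundary, Finsupp.linearCombination_single]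

theorem boundary_simplexBoundary (s : Finset α) : boundary (simplexBoundary s) = 0 := by
  have key : ∀ v ∈ s, ∀ u ∈ s, u < v →
      (-1 : ℤ) ^ (s.filter (· < v)).card * (-1 : ℤ) ^ ((s.erase v).filter (· < u)).card
        + (-1 : ℤ) ^ (s.filter (· < u)).card * (-1 : ℤ) ^ ((s.erase u).filter (· < v)).card
        = 0 := by
    intro v _ u hu huv
    have h1 : (s.erase v).filter (· < u) = s.filter (· < u) := by
      ext w
      simp only [mem_filter, mem_erase]
      constructor
      · rintro ⟨⟨_, h⟩, h'⟩
        exact ⟨h, h'⟩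
      · rintro ⟨h, h'⟩
        exact ⟨⟨(h'.trans huv).ne, h⟩, h'⟩
    have h2 : (s.filter (· < v)).card = ((s.erase u).filter (· < v)).card + 1 := by
      have h3 : (s.erase u).filter (· < v) = (s.filter (· < v)).erase u := by
        ext w
        simp only [mem_filter, mem_erase, and_assoc]
      rw [h3, card_erase_add_one (mem_filter.2 ⟨hu, huv⟩)]
    rw [h1, h2]
    ring
  simp only [simplexBoundary, map_sum, boundary_single, Finset.smul_sum, Finsupp.smul_single,
    smul_eq_mul]
  rw [Finset.sum_sigma']
  refine Finset.sum_involution (fun p _ => ⟨p.2, p.1⟩) ?_ ?_ ?_ ?_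
  · rintro ⟨v, u⟩ h
    simp only [mem_sigma, mem_erase] at h
    obtain ⟨hv, huv, hu⟩ := h
    simp only
    rw [Finset.erase_right_comm (a := u) (b := v), ← Finsupp.single_add]
    rcases lt_or_gt_of_ne huv with h | h
    · rw [key v hv u hu h, Finsupp.single_zero]
    · rw [add_comm, key u hu v hv h, Finsupp.single_zero]
  · rintro ⟨v, u⟩ h _ heq
    simp only [mem_sigma, mem_erase] at h
    simp only [Sigma.mk.injEq] at heq
    exact h.2.1 heq.1
  · rintro ⟨v, u⟩ h
    simp only [mem_sigma, mem_erase] at h ⊢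
    exact ⟨h.2.2, h.2.1.symm, h.1⟩
  · rintro ⟨v, u⟩ h
    rfl

/-- The boundary operator squares to zero. -/
theorem boundary_boundary (x : Finset α →₀ ℤ) : boundary (boundary x) = 0 := by
  induction x using Finsupp.induction_linear with
  | zero => simp
  | add f g hf hg => simp [hf, hg]
  | single s a => rw [boundary_single, map_smul, boundary_simplexBoundary, smul_zero]

/-- The boundary operator maps `i + 1`-chains to `i`-chains. -/
theorem boundary_mem_chains (K : PreAbstractSimplicialComplex α) (i : ℤ) {x : Finset α →₀ ℤ}
    (hx : x ∈ K.chains (i + 1)) : boundary x ∈ K.chains i := by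
  rw [boundary, Finsupp.linearCombination_apply]
  refine Submodule.sum_mem _ fun s hs => Submodule.smul_mem _ _ (Submodule.sum_mem _ fun v hv => ?_)
  obtain ⟨hsK, hcard⟩ := (Finsupp.mem_supported _ _).1 hx hs
  refine Finsupp.single_mem_supported _ _ ⟨?_, ?_⟩
  · rcases (s.erase v).eq_empty_or_nonempty with h | h
    · exact Or.inl h
    · refine Or.inr ?_
      rcases hsK with h0 | hsK
      · simp [h0] at hv
      · exact (K.isRelLowerSet_faces hsK).2 (erase_subset v s) h
  · have := card_erase_add_one hv
    omega

/-- The `i`-cycles: the kernel of the boundary operator on `i`-chains. -/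
noncomputable def cycles (K : PreAbstractSimplicialComplex α) (i : ℤ) :
    Submodule ℤ (Finset α →₀ ℤ) :=
  K.chains i ⊓ LinearMap.ker boundary

/-- The `i`-boundaries: the image of the `(i + 1)`-chains under the boundary operator. -/
noncomputable def boundaries (K : PreAbstractSimplicialComplex α) (i : ℤ) :
    Submodule ℤ (Finset α →₀ ℤ) :=
  (K.chains (i + 1)).map boundary

theorem boundaries_le_cycles (K : PreAbstractSimplicialComplex α) (i : ℤ) :
    K.boundaries i ≤ K.cycles i := by
  rintro _ ⟨x, hx, rfl⟩
  exact ⟨K.boundary_mem_chains i hx, boundary_boundary x⟩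

/-- Reduced simplicial homology `H̃ᵢ(K; ℤ)`: cycles modulo boundaries of the augmented oriented
chain complex. -/
abbrev ReducedHomology (K : PreAbstractSimplicialComplex α) (i : ℤ) : Type _ :=
  K.cycles i ⧸ (K.boundaries i).submoduleOf (K.cycles i)

open Classical in
/-- The homological connectivity `conn_h(K)`: it is `∞` if all reduced homology groups vanish, and
otherwise the greatest integer `k` such that `H̃ᵢ(K; ℤ) = 0` for every `-1 ≤ i ≤ k`. -/
noncomputable def homConn (K : PreAbstractSimplicialComplex α) : WithTop ℤ :=
  if ∀ i : ℤ, Subsingleton (K.ReducedHomology i) then ⊤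
  else ((sSup {k : ℤ | ∀ i : ℤ, -1 ≤ i → i ≤ k → Subsingleton (K.ReducedHomology i)} : ℤ) :
    WithTop ℤ)

end PreAbstractSimplicialComplex

/-! ### Augmented chains -/

namespace PreAbstractSimplicialComplex

variable {α : Type*}

/-! Induct on the number of edges. Relative chains of the pair `(Ind(C - F), Ind(C))` are spanned by
the faces containing `F`; removing `F` identifies them, up to a degree shift by `|F|`, with chains
of the link of `F` in `Ind(C - F)`, which is `Ind(C : F)` (`mem_augFaces_contract`). The long exact
sequence then traps `H̃ᵢ(Ind C)` between `H̃_{i+1-|F|}(Ind(C : F))` and `H̃ᵢ(Ind(C - F))`. For an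
edge `F` attaining the maximum in `ψ`, both outer groups vanish when `i ≤ ψ(C) - 2`. The exact
sequence is replaced by an explicit chase with the chain map `linkMap` and its section `joinMap`, in
`cycles_le_boundaries_of_deleteEdge_of_contract`. The base cases are the complex `{∅}` and a full
simplex, which is a cone. -/

theorem mem_chains_iff {K : PreAbstractSimplicialComplex α} {i : ℤ} {x : Finset α →₀ ℤ} :
    x ∈ K.chains i ↔ ∀ s, x s ≠ 0 → s ∈ K.augFaces ∧ (s.card : ℤ) = i + 1 := by
  rw [chains, Finsupp.mem_supported]
  exact ⟨fun h s hs => h (Finsupp.mem_support_iff.2 hs),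
    fun h s hs => h s (Finsupp.mem_support_iff.1 hs)⟩

theorem chains_eq_bot (K : PreAbstractSimplicialComplex α) {i : ℤ} (hi : i < -1) :
    K.chains i = ⊥ := by
  refine (Submodule.eq_bot_iff _).2 fun x hx => Finsupp.ext fun s => ?_
  by_contra h
  have := (mem_chains_iff.1 hx s h).2
  omega

variable [LinearOrder α]

/-! ### Passing to the link of a face, on chains -/

/-- The sign relating a face `τ` of the link of `F` to the face `τ ∪ F`. -/
def joinSign (F τ : Finset α) : ℤ := ∏ v ∈ τ, (-1 : ℤ) ^ (F.filter (· < v)).card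

theorem joinSign_mul_self (F τ : Finset α) : joinSign F τ * joinSign F τ = 1 := by
  rw [joinSign, ← prod_mul_distrib]
  refine prod_eq_one fun v _ => ?_
  rw [← mul_pow]
  simp

theorem joinSign_ne_zero (F τ : Finset α) : joinSign F τ ≠ 0 := fun h => by
  simpa [h] using joinSign_mul_self F τ

/-- The map sending a simplex containing `F` to its face opposite to `F`, up to sign, and the other
simplices to zero. -/
noncomputable def linkMap (F : Finset α) : (Finset α →₀ ℤ) →ₗ[ℤ] (Finset α →₀ ℤ) :=
  Finsupp.linearCombination ℤ fun s =>
    if F ⊆ s then Finsupp.single (s \ F) (joinSign F (s \ F)) else 0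

/-- The map sending a simplex `τ` to the simplex `τ ∪ F`, up to sign. -/
noncomputable def joinMap (F : Finset α) : (Finset α →₀ ℤ) →ₗ[ℤ] (Finset α →₀ ℤ) :=
  Finsupp.linearCombination ℤ fun t => Finsupp.single (t ∪ F) (joinSign F t)

theorem linkMap_single (F s : Finset α) (a : ℤ) :
    linkMap F (Finsupp.single s a) =
      if F ⊆ s then Finsupp.single (s \ F) (a * joinSign F (s \ F)) else 0 := by
  rw [linkMap, Finsupp.linearCombination_single]
  split_ifs <;> simp

theorem linkMap_apply (F : Finset α) (x : Finset α →₀ ℤ) (t : Finset α) :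
    linkMap F x t = if Disjoint t F then joinSign F t * x (t ∪ F) else 0 := by
  induction x using Finsupp.induction_linear with
  | zero => simp
  | add f g hf hg =>
    rw [map_add, Finsupp.add_apply, hf, hg]
    split_ifs <;> simp [mul_add]
  | single s a =>
    rw [linkMap_single]
    by_cases ht : Disjoint t F
    · rw [if_pos ht]
      by_cases hs : s = t ∪ F
      · subst hs
        rw [if_pos subset_union_right, union_sdiff_cancel_right ht]
        simp [mul_comm]
      · rw [Finsupp.single_eq_of_ne (Ne.symm hs), mul_zero]
        split_ifs with hF
        · refine Finsupp.single_eq_of_ne fun h => hs ?_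
          rw [h, sdiff_union_of_subset hF]
        · rfl
    · rw [if_neg ht]
      split_ifs with hF
      · refine Finsupp.single_eq_of_ne fun h => ht ?_
        rw [h]
        exact sdiff_disjoint
      · rfl

/-- Erasing a vertex of `F` gives a term killed by `linkMap`. For `v ∉ F`, the position of `v` in
`s` exceeds its position in `s \ F` by the number of vertices of `F` below `v`, and this is exactly
the factor of `joinSign` lost on erasing `v`. Hence `linkMap` commutes with the boundary without any
extra sign. -/
theorem linkMap_simplexBoundary (F s : Finset α) :
    linkMap F (simplexBoundary s) = boundary (linkMap F (Finsupp.single s 1)) := by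
  rw [linkMap_single]
  simp only [simplexBoundary, map_sum, linkMap_single]
  split_ifs with hF
  · have hsub : s \ F ⊆ s := sdiff_subset
    rw [boundary_single, simplexBoundary, smul_sum, ← sum_subset hsub]
    · refine sum_congr rfl fun v hv => ?_
      obtain ⟨hvs, hvF⟩ := mem_sdiff.1 hv
      have hsd : s.erase v \ F = (s \ F).erase v := erase_sdiff_comm _ _ _
      have hpos : (s.filter (· < v)).card =
          ((s \ F).filter (· < v)).card + (F.filter (· < v)).card := by
        rw [← card_union_of_disjoint (disjoint_filter_filter sdiff_disjoint), ← filter_union,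
          sdiff_union_of_subset hF]
      have hsign : joinSign F (s \ F) =
          (-1 : ℤ) ^ (F.filter (· < v)).card * joinSign F ((s \ F).erase v) :=
        (mul_prod_erase _ _ hv).symm
      rw [if_pos (subset_erase.2 ⟨hF, hvF⟩), hsd, Finsupp.smul_single, hpos, hsign, pow_add]
      congr 1
      rw [smul_eq_mul]
      ring
    · intro v hvs hv
      have hvF : v ∈ F := by
        by_contra h
        exact hv (mem_sdiff.2 ⟨hvs, h⟩)
      exact if_neg fun h => (mem_erase.1 (h hvF)).1 rfl
  · rw [map_zero]
    exact sum_eq_zero fun v _ => if_neg fun h => hF (h.trans (erase_subset _ _))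

theorem linkMap_boundary (F : Finset α) (x : Finset α →₀ ℤ) :
    linkMap F (boundary x) = boundary (linkMap F x) := by
  induction x using Finsupp.induction_linear with
  | zero => simp
  | add f g hf hg => simp only [map_add, hf, hg]
  | single s a =>
    rw [boundary_single, map_smul, linkMap_simplexBoundary, ← map_smul, ← map_smul,
      Finsupp.smul_single, smul_eq_mul, mul_one]

/-- The two signs agree and square to one. Only this section property is needed; `joinMap` need not
be a chain map. -/
theorem linkMap_joinMap (F : Finset α) {y : Finset α →₀ ℤ}
    (hy : ∀ t, y t ≠ 0 → Disjoint t F) : linkMap F (joinMap F y) = y := by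
  conv_rhs => rw [← Finsupp.sum_single y]
  rw [joinMap, Finsupp.linearCombination_apply, Finsupp.sum, map_sum, Finsupp.sum]
  refine sum_congr rfl fun t ht => ?_
  have hd := hy t (Finsupp.mem_support_iff.1 ht)
  rw [Finsupp.smul_single, linkMap_single, if_pos subset_union_right,
    union_sdiff_cancel_right hd, smul_eq_mul, mul_assoc, joinSign_mul_self, mul_one]

/-! ### Cones -/

/-- Adding the vertex `v` to all simplices not containing it. -/
noncomputable def coneMap (v : α) : (Finset α →₀ ℤ) →ₗ[ℤ] (Finset α →₀ ℤ) :=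
  Finsupp.linearCombination ℤ fun s => if v ∈ s then 0 else Finsupp.single (insert v s) 1

theorem coneMap_single (v : α) (s : Finset α) (a : ℤ) :
    coneMap v (Finsupp.single s a) = if v ∈ s then 0 else Finsupp.single (insert v s) a := by
  rw [coneMap, Finsupp.linearCombination_single]
  split_ifs <;> simp

/-- The cone is a contracting homotopy. Taking the apex below all vertices puts it in position zero,
so coning needs no sign and shifts every other position by one. -/
theorem boundary_coneMap_single {v : α} {s : Finset α} (hv : ∀ u ∈ s, v ≤ u) :
    boundary (coneMap v (Finsupp.single s 1)) + coneMap v (simplexBoundary s) =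
      Finsupp.single s 1 := by
  simp only [simplexBoundary, map_sum, coneMap_single]
  by_cases hvs : v ∈ s
  · rw [if_pos hvs, map_zero, zero_add, sum_eq_single_of_mem v hvs]
    · rw [if_neg (notMem_erase v s), insert_erase hvs, filter_eq_empty_iff.2]
      · simp
      · exact fun u hu => not_lt.2 (hv u hu)
    · exact fun u _ huv => if_pos (mem_erase.2 ⟨huv.symm, hvs⟩)
  · rw [if_neg hvs, boundary_single, one_smul, simplexBoundary, sum_insert hvs,
      erase_insert hvs, filter_eq_empty_iff.2, card_empty, pow_zero, add_assoc,
      ← sum_add_distrib, sum_eq_zero, add_zero]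
    · intro u hu
      have huv : v ≠ u := fun h => hvs (h ▸ hu)
      have hlt : v < u := lt_of_le_of_ne (hv u hu) huv
      rw [if_neg fun h => hvs (mem_of_mem_erase h), filter_insert, if_pos hlt,
        card_insert_of_notMem fun h => hvs (mem_filter.1 h).1, erase_insert_of_ne huv,
        ← Finsupp.single_add, pow_succ]
      simp
    · intro u hu
      rcases mem_insert.1 hu with rfl | hu
      · exact lt_irrefl _
      · exact not_lt.2 (hv u hu)

theorem boundary_coneMap {v : α} {x : Finset α →₀ ℤ} (hx : ∀ s, x s ≠ 0 → ∀ u ∈ s, v ≤ u) :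
    boundary (coneMap v x) + coneMap v (boundary x) = x := by
  suffices h : ∀ s ∈ x.support,
      boundary (coneMap v (Finsupp.single s (x s))) +
        coneMap v (boundary (Finsupp.single s (x s))) = Finsupp.single s (x s) by
    have hsum := sum_congr rfl h
    rw [sum_add_distrib] at hsum
    simp only [← map_sum] at hsum
    have hx' : ∑ s ∈ x.support, Finsupp.single s (x s) = x := Finsupp.sum_single x
    rwa [hx'] at hsum
  intro s hs
  have h := congrArg (x s • ·) (boundary_coneMap_single (hx s (Finsupp.mem_support_iff.1 hs)))
  simpa only [smul_add, ← map_smul, Finsupp.smul_single, smul_eq_mul, mul_one, boundary_single,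
    one_smul] using h

/-! ### Vanishing homology and connectivity -/

theorem subsingleton_reducedHomology_iff (K : PreAbstractSimplicialComplex α) (i : ℤ) :
    Subsingleton (K.ReducedHomology i) ↔ K.cycles i ≤ K.boundaries i := by
  rw [Submodule.Quotient.subsingleton_iff, Submodule.submoduleOf_eq_top]

theorem subsingleton_reducedHomology_of_lt (K : PreAbstractSimplicialComplex α) {i : ℤ}
    (hi : i < -1) : Subsingleton (K.ReducedHomology i) := by
  rw [subsingleton_reducedHomology_iff, cycles, chains_eq_bot K hi, bot_inf_eq]
  exact bot_le

theorem le_homConn (K : PreAbstractSimplicialComplex α) {m : ℤ}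
    (h : ∀ i, i ≤ m → Subsingleton (K.ReducedHomology i)) : (m : WithTop ℤ) ≤ K.homConn := by
  rw [homConn]
  split_ifs with hall
  · exact le_top
  · obtain ⟨j, hj⟩ := not_forall.1 hall
    -- The supremum in `ℤ` is meaningful only for a bounded set: a degree `j` with nonzero homology,
    -- necessarily at least `-1`, is an upper bound.
    refine WithTop.coe_le_coe.2 (le_csSup ⟨j, fun k hk => ?_⟩ fun i _ hi => h i hi)
    by_contra! hlt
    refine hj (hk j ?_ hlt.le)
    by_contra! hj'
    exact hj (subsingleton_reducedHomology_of_lt K hj')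

end PreAbstractSimplicialComplex

/-! ### Faces under deletion and contraction of an edge -/

namespace FinHypergraph

open PreAbstractSimplicialComplex

variable {α : Type*}

theorem mem_augFaces_indepComplex (C : FinHypergraph α) (s : Finset α) :
    s ∈ C.indepComplex.augFaces ↔ s ⊆ C.verts ∧ ∀ E ∈ C.edges, ¬ E ⊆ s := by
  constructor
  · rintro (rfl | hs)
    · refine ⟨empty_subset _, fun E hE h => ?_⟩
      have := C.two_le_card E hE
      rw [subset_empty.1 h, card_empty] at this
      omega
    · exact hs.2
  · intro h
    rcases s.eq_empty_or_nonempty with h0 | h0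
    · exact Or.inl h0
    · exact Or.inr ⟨h0, h⟩

theorem exists_minimal_trace [DecidableEq α] (C : FinHypergraph α) {F S : Finset α}
    (hS : S ∈ C.traces F) : ∃ T ∈ C.traces F, T ⊆ S ∧ ∀ U ∈ C.traces F, U ⊆ T → U = T := by
  obtain ⟨T, hTS, hT⟩ := (C.traces F).exists_le_minimal hS
  exact ⟨T, hT.1, hTS, fun U hU hUT => le_antisymm hUT (hT.2 hU hUT)⟩

/-- An edge `E ≠ F` lies in `t ∪ F` exactly when its trace `E \ F` lies in `t`, and minimal traces
suffice. They are nonempty by incomparability; the singletons are excluded through `nbr`, and the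
others are the edges of `C : F`. -/
theorem mem_augFaces_contract [DecidableEq α] (C : FinHypergraph α) {F : Finset α}
    (hF : F ∈ C.edges) (t : Finset α) :
    t ∈ (C.contract F).indepComplex.augFaces ↔
      Disjoint t F ∧ t ∪ F ∈ (C.deleteEdge F).indepComplex.augFaces := by
  simp only [mem_augFaces_indepComplex]
  constructor
  · rintro ⟨htV, htE⟩
    have htF : Disjoint t F := disjoint_left.2 fun v hv hvF =>
      (mem_sdiff.1 (htV hv)).2 (mem_union_left _ hvF)
    refine ⟨htF, union_subset (htV.trans sdiff_subset) (C.subset_verts F hF), fun E hE hEt => ?_⟩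
    obtain ⟨T, hT, hTE, hmin⟩ := C.exists_minimal_trace (mem_image_of_mem (· \ F) hE)
    have hTt : T ⊆ t := hTE.trans (sdiff_le_iff.2 (by rwa [sup_comm]))
    obtain ⟨G, hG, rfl⟩ := mem_image.1 hT
    obtain ⟨hGF, hGC⟩ := mem_erase.1 hG
    rcases lt_or_ge (G \ F).card 2 with hc | hc
    · interval_cases hcard : (G \ F).card
      · exact hGF (C.incomparable G hGC F hF (sdiff_eq_empty_iff_subset.1 (card_eq_zero.1 hcard)))
      · obtain ⟨w, hw⟩ := card_eq_one.1 hcard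
        have hwG : w ∈ G \ F := hw ▸ mem_singleton_self w
        refine (mem_sdiff.1 (htV (hTt hwG))).2 (mem_union_right _ ?_)
        exact mem_biUnion.2 ⟨G, mem_filter.2 ⟨hGC, hcard⟩, hwG⟩
    · exact htE _ (mem_filter.2 ⟨hT, hmin, hc⟩) hTt
  · rintro ⟨htF, htV, htE⟩
    have key : ∀ E ∈ C.edges, E ≠ F → ¬ E \ F ⊆ t := fun E hE hEF h =>
      htE E (mem_erase.2 ⟨hEF, hE⟩) (by rw [union_comm]; exact sdiff_le_iff.1 h)
    refine ⟨fun v hv => mem_sdiff.2 ⟨htV (mem_union_left _ hv), fun hvF => ?_⟩, fun S hS hSt => ?_⟩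
    · rcases mem_union.1 hvF with h | h
      · exact disjoint_left.1 htF hv h
      · obtain ⟨G, hG, hvG⟩ := mem_biUnion.1 h
        obtain ⟨hGC, hG1⟩ := mem_filter.1 hG
        refine key G hGC (fun h => by simp [h] at hG1) ?_
        obtain ⟨w, hw⟩ := card_eq_one.1 hG1
        rw [hw, mem_singleton] at hvG
        rw [hw, ← hvG]
        exact singleton_subset_iff.2 hv
    · obtain ⟨E, hE, rfl⟩ := mem_image.1 (mem_filter.1 hS).1
      exact key E (mem_of_mem_erase hE) (ne_of_mem_erase hE) hSt

theorem mem_augFaces_of_deleteEdge [DecidableEq α] (C : FinHypergraph α) {F s : Finset α}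
    (hs : s ∈ (C.deleteEdge F).indepComplex.augFaces) (hFs : ¬ F ⊆ s) :
    s ∈ C.indepComplex.augFaces := by
  rw [mem_augFaces_indepComplex] at hs ⊢
  refine ⟨hs.1, fun E hE => ?_⟩
  by_cases hEF : E = F
  · rwa [hEF]
  · exact hs.2 E (mem_erase.2 ⟨hEF, hE⟩)

theorem augFaces_subset_deleteEdge [DecidableEq α] (C : FinHypergraph α) (F : Finset α) :
    C.indepComplex.augFaces ⊆ (C.deleteEdge F).indepComplex.augFaces := fun s hs => by
  rw [mem_augFaces_indepComplex] at hs ⊢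
  exact ⟨hs.1, fun E hE => hs.2 E (mem_of_mem_erase hE)⟩

/-! ### The exact sequence and the induction -/

variable [LinearOrder α]

theorem cycles_le_boundaries_of_edges_eq_empty (C : FinHypergraph α) (hV : C.verts ≠ ∅)
    (hE : C.edges = ∅) (i : ℤ) : C.indepComplex.cycles i ≤ C.indepComplex.boundaries i := by
  rintro z ⟨hz, hz0⟩
  have hne := nonempty_iff_ne_empty.2 hV
  have haug : ∀ s, s ∈ C.indepComplex.augFaces ↔ s ⊆ C.verts := fun s => by
    simp [mem_augFaces_indepComplex, hE]
  set v := C.verts.min' hne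
  have hcone := boundary_coneMap (v := v) (x := z) fun s hs u hu =>
    C.verts.min'_le u ((haug s).1 (mem_chains_iff.1 hz s hs).1 hu)
  rw [LinearMap.mem_ker.1 hz0, map_zero, add_zero] at hcone
  refine ⟨coneMap v z, ?_, hcone⟩
  rw [coneMap, Finsupp.linearCombination_apply]
  refine Submodule.sum_mem _ fun s hs => Submodule.smul_mem _ _ ?_
  obtain ⟨hsV, hcard⟩ := mem_chains_iff.1 hz s (Finsupp.mem_support_iff.1 hs)
  split_ifs with hvs
  · exact Submodule.zero_mem _
  · refine Finsupp.single_mem_supported _ _ ⟨(haug _).2 ?_, ?_⟩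
    · exact insert_subset (C.verts.min'_mem hne) ((haug s).1 hsV)
    · rw [card_insert_of_notMem hvs]
      push_cast
      omega

/-- The part of the long exact sequence of the pair `(Ind(C - F), Ind(C))` in which the relative
homology is identified with that of `Ind(C : F)`. -/
theorem cycles_le_boundaries_of_deleteEdge_of_contract (C : FinHypergraph α) {F : Finset α}
    (hF : F ∈ C.edges) {i : ℤ}
    (hdel : (C.deleteEdge F).indepComplex.cycles i ≤ (C.deleteEdge F).indepComplex.boundaries i)
    (hcon : (C.contract F).indepComplex.cycles (i + 1 - F.card) ≤
      (C.contract F).indepComplex.boundaries (i + 1 - F.card)) :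
    C.indepComplex.cycles i ≤ C.indepComplex.boundaries i := by
  rintro z ⟨hz, hz0⟩
  obtain ⟨x, hx, rfl⟩ : z ∈ (C.deleteEdge F).indepComplex.boundaries i :=
    hdel ⟨mem_chains_iff.2 fun s hs =>
      ⟨C.augFaces_subset_deleteEdge F (mem_chains_iff.1 hz s hs).1,
        (mem_chains_iff.1 hz s hs).2⟩, hz0⟩
  -- No face of `Ind(C)` contains `F`, so `x` is a relative cycle and its image in the link is a
  -- cycle.
  have hlink0 : linkMap F (boundary x) = 0 := by
    refine Finsupp.ext fun t => ?_
    rw [linkMap_apply]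
    split_ifs
    · rw [Finsupp.zero_apply, mul_eq_zero]
      right
      by_contra h
      exact ((C.mem_augFaces_indepComplex _).1 (mem_chains_iff.1 hz _ h).1).2 F hF
        subset_union_right
    · rfl
  have hlink : linkMap F x ∈ (C.contract F).indepComplex.chains (i + 1 - F.card) := by
    refine mem_chains_iff.2 fun t ht => ?_
    rw [linkMap_apply] at ht
    split_ifs at ht with hd
    · obtain ⟨haug, hcard⟩ := mem_chains_iff.1 hx _ (right_ne_zero_of_mul ht)
      refine ⟨(C.mem_augFaces_contract hF t).2 ⟨hd, haug⟩, ?_⟩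
      rw [card_union_of_disjoint hd] at hcard
      push_cast at hcard
      omega
    · exact absurd rfl ht
  obtain ⟨y, hy, hyx⟩ := hcon ⟨hlink, by rw [SetLike.mem_coe, LinearMap.mem_ker,
    ← linkMap_boundary, hlink0]⟩
  have hy' : ∀ t, y t ≠ 0 → (Disjoint t F ∧ t ∪ F ∈ (C.deleteEdge F).indepComplex.augFaces) ∧
      (t.card : ℤ) = i + 1 - F.card + 1 + 1 := fun t ht => by
    rw [← C.mem_augFaces_contract hF]
    exact mem_chains_iff.1 hy t ht
  have hjoin : joinMap F y ∈ (C.deleteEdge F).indepComplex.chains (i + 1 + 1) := by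
    rw [joinMap, Finsupp.linearCombination_apply]
    refine Submodule.sum_mem _ fun t ht => Submodule.smul_mem _ _ ?_
    obtain ⟨⟨hd, haug⟩, hcard⟩ := hy' t (Finsupp.mem_support_iff.1 ht)
    refine Finsupp.single_mem_supported _ _ ⟨haug, ?_⟩
    rw [card_union_of_disjoint hd]
    push_cast
    omega
  -- This correction leaves the boundary of `x` unchanged and cancels every simplex containing `F`,
  -- so the result is a chain of `Ind(C)`.
  have hsub : x - boundary (joinMap F y) ∈ (C.deleteEdge F).indepComplex.chains (i + 1) :=
    Submodule.sub_mem _ hx (boundary_mem_chains _ _ hjoin)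
  have hzero : linkMap F (x - boundary (joinMap F y)) = 0 := by
    rw [map_sub, linkMap_boundary, linkMap_joinMap F fun t ht => (hy' t ht).1.1, hyx, sub_self]
  refine ⟨x - boundary (joinMap F y), mem_chains_iff.2 fun s hs => ?_, ?_⟩
  · obtain ⟨haug, hcard⟩ := mem_chains_iff.1 hsub s hs
    refine ⟨C.mem_augFaces_of_deleteEdge haug fun hFs => hs ?_, hcard⟩
    have h := DFunLike.congr_fun hzero (s \ F)
    rw [linkMap_apply, if_pos sdiff_disjoint, sdiff_union_of_subset hFs, Finsupp.zero_apply] at h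
    exact (mul_eq_zero.1 h).resolve_left (joinSign_ne_zero _ _)
  · rw [map_sub, boundary_boundary, sub_zero]

/-- A natural number `n` below `ψ` treats finite and infinite values alike. There is no lower bound
on `i`, since the degree for `C : F` may fall below `-1`. -/
theorem cycles_le_boundaries_of_le_psi (C : FinHypergraph α) (n : ℕ) (hn : (n : ℕ∞) ≤ C.psi)
    (i : ℤ) (hi : i + 2 ≤ n) : C.indepComplex.cycles i ≤ C.indepComplex.boundaries i := by
  rw [psi] at hn
  split_ifs at hn with hV hE
  · rw [← subsingleton_reducedHomology_iff]
    refine subsingleton_reducedHomology_of_lt _ ?_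
    have : n = 0 := by simpa using hn
    omega
  · exact C.cycles_le_boundaries_of_edges_eq_empty hV hE i
  · obtain ⟨F, -, hF⟩ := exists_mem_eq_sup _ (attach_nonempty_iff.2 (nonempty_iff_ne_empty.2 hE))
      fun F : C.edges => min (psi (C.deleteEdge F.1))
        (psi (C.contract F.1) + ((F.1.card - 1 : ℕ) : ℕ∞))
    rw [hF, le_min_iff] at hn
    refine C.cycles_le_boundaries_of_deleteEdge_of_contract F.2
      (cycles_le_boundaries_of_le_psi _ n hn.1 i hi)
      -- Truncated subtraction is harmless: it only enlarges the bound that the shifted degree has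
      -- to meet.
      (cycles_le_boundaries_of_le_psi _ (n - (F.1.card - 1)) ?_ _ ?_)
    · rw [ENat.natCast_sub]
      exact tsub_le_iff_right.2 hn.2
    · have := C.two_le_card F.1 F.2
      omega
termination_by C.edges.card
decreasing_by
  · exact C.card_edges_deleteEdge_lt F.2
  · exact C.card_edges_contract_lt F.2

end FinHypergraph

theorem mainTheorem4 {α : Type*} [LinearOrder α] (C : FinHypergraph α) :
    (C.psi.map (fun n : ℕ => (n : ℤ)) : WithTop ℤ) - 2 ≤ C.indepComplex.homConn := by
  have key := fun n hn i hi =>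
    (PreAbstractSimplicialComplex.subsingleton_reducedHomology_iff _ i).2 (C.cycles_le_boundaries_of_le_psi n hn i hi)
  cases hpsi : C.psi with
  | top =>
    have hall : ∀ i : ℤ, Subsingleton (C.indepComplex.ReducedHomology i) := fun i =>
      key (i + 2).toNat (hpsi ▸ le_top) i (Int.self_le_toNat _)
    rw [PreAbstractSimplicialComplex.homConn, if_pos hall]
    exact le_top
  | coe n => exact PreAbstractSimplicialComplex.le_homConn _ (m := (n : ℤ) - 2) fun i hi => key n hpsi.ge i (by omega)
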